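/- Let $-\infty\le a<b\le\infty$, let $V\in L^1_{\mathrm{loc}}(a,b)$ be real-valued, let $I\subseteq\mathbb Z$, and let $M=\{x_n\}_{n\in I}\subset(a,b)$ consist of distinct points with no accumulation point in $(a,b)$. For $\alpha,\theta\in\mathbb R$ and $r>0$ put $$A_{\alpha,r,\theta}=\begin{pmatrix}1&\alpha\\0&1\end{pmatrix}\begin{pmatrix}r&0\\0&1/r\end{pmatrix}\begin{pmatrix}\cos\theta&-\sin\theta\\ \sin\theta&\cos\theta\end{pmatrix}.$$ Fix $\Lambda=(\alpha_n)_{n\in I}\in\mathbb R^I$ and $R=(r_n)_{n\in I}\in(0,\infty)^I$. For $\Theta=(\theta_n)_{n\in I}\in\mathbb R^I$ and $z\in\mathbb C$, a solution of $(\tau_\Theta-z)f=0$ is a function $f$ such that $f,f'$ are locally absolutely continuous in $(a,b)\setminus M$, $-f''+Vf=zf$ almost everywhere, and $$\begin{pmatrix}f(x_n+)\\f'(x_n+)\end{pmatrix}=A_{\alpha_n,r_n,\theta_n}\begin{pmatrix}f(x_n-)\\f'(x_n-)\end{pmatrix}\qquad(n\in I).\tag{1}$$ Call $\tau_\Theta$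 limit point at $a$ (at $b$) if for every $z\in\mathbb C$ some solution of $(\tau_\Theta-z)f=0$ is not square integrable near $a$ (near $b$). Call it regular at $a$ if $a$ is finite, $V\in L^1_{\mathrm{loc}}[a,b)$ and $a$ is not an accumulation point of $M$; similarly at $b$ (with $L^1_{\mathrm{loc}}(a,b]$). Assume that, for every $\Theta\in\mathbb R^I$, $\tau_\Theta$ is limit point or regular at $a$, and limit point or regular at $b$. Fix $\psi_a,\psi_b\in\mathbb R$ and let $H_\Theta$ be the operator $H_\Theta f=-f''+Vf$ in $L^2(a,b)$ whose domain consists of all $f\in L^2(a,b)$ such that $f,f'$ are locally absolutely continuous in $(a,b)\setminus M$, $-f''+Vf\in L^2(a,b)$, (1) holds, and $f(a)\cos\psi_a+f'(a)\sin\psi_a=0$ if $a$ is regular, $f(b)\cos\psi_b+f'(b)\sin\psi_b=0$ if $b$ is regular. Let $\sigma_p(H_\Theta)$ be its set of eigenvalues. Let $(q_n)_{n\in I}$ be Borel probability measures on $\mathbb R$ and let $\mathbb P_3=\times_{n\in I}q_n$ be the product measure on $\mathbb R^I$. Assume that $q_{n_0}$ is continuous (i.e. $q_{n_0}(\{t\})=0$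 for every $t\in\mathbb R$) for at least one $n_0\in I$. Then for every $E\in\mathbb R$ and every subset $B$ of $\{\Theta\in\mathbb R^I: E\in\sigma_p(H_\Theta)\}$ that is measurable with respect to the product $\sigma$-algebra, or more generally with respect to its $\mathbb P_3$-completion, $\mathbb P_3(B)=0$. -/

import Mathlib

open MeasureTheory Set Filter Topology

noncomputable section

/-- `P_α = [[1, α], [0, 1]]`. -/
def parabolicMatrix (α : ℝ) : Matrix (Fin 2) (Fin 2) ℝ := !![1, α; 0, 1]

/-- `H_r = [[r, 0], [0, 1/r]]` (used for `r > 0`). -/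
def hyperbolicMatrix (r : ℝ) : Matrix (Fin 2) (Fin 2) ℝ := !![r, 0; 0, 1 / r]

/-- `E_θ`, the rotation by the angle `θ`. -/
def ellipticMatrix (θ : ℝ) : Matrix (Fin 2) (Fin 2) ℝ :=
  !![Real.cos θ, -Real.sin θ; Real.sin θ, Real.cos θ]

/-- The matrix with Iwasawa decomposition `P_α H_r E_θ`. -/
def interactionMatrix (α r θ : ℝ) : Matrix (Fin 2) (Fin 2) ℝ :=
  parabolicMatrix α * hyperbolicMatrix r * ellipticMatrix θ

/-- The differential expression `τ f = -f'' + V f`. -/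
def sturmExpr (V : ℝ → ℝ) (f : ℝ → ℂ) : ℝ → ℂ :=
  fun x => -deriv (deriv f) x + (V x : ℂ) * f x

/-- `f, f'` have one-sided limits at `p`, and `(f(p+), f'(p+))ᵀ = A (f(p-), f'(p-))ᵀ`. -/
def JumpCondition (A : Matrix (Fin 2) (Fin 2) ℝ) (f : ℝ → ℂ) (p : ℝ) : Prop :=
  ∃ l r : Fin 2 → ℂ,
    Tendsto f (𝓝[<] p) (𝓝 (l 0)) ∧ Tendsto (deriv f) (𝓝[<] p) (𝓝 (l 1)) ∧
    Tendsto f (𝓝[>] p) (𝓝 (r 0)) ∧ Tendsto (deriv f) (𝓝[>] p) (𝓝 (r 1)) ∧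
    r = (A.map (fun t : ℝ => (t : ℂ))).mulVec l

/-- `f` and `f'` are (locally) absolutely continuous in the set `U`: `f` is differentiable in `U`,
and `f`, `f'` are absolutely continuous on every compact interval contained in `U`. -/
structure LocallyAC₂ (f : ℝ → ℂ) (U : Set ℝ) : Prop where
  differentiableAt : ∀ y ∈ U, DifferentiableAt ℝ f y
  ac : ∀ c d : ℝ, c ≤ d → Icc c d ⊆ U → AbsolutelyContinuousOnInterval f c d
  ac_deriv : ∀ c d : ℝ, c ≤ d → Icc c d ⊆ U → AbsolutelyContinuousOnInterval (deriv f) c d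

/-- The set of eigenvalues of a (possibly unbounded) linear operator. -/
def pointSpectrum {H : Type*} [AddCommGroup H] [Module ℂ H] (T : H →ₗ.[ℂ] H) : Set ℂ :=
  {z | ∃ φ : T.domain, φ ≠ 0 ∧ T φ = z • (φ : H)}

/-- The non-random data: an interval `(a, b)` with `-∞ ≤ a < b ≤ ∞`, a real potential
`V ∈ L¹_loc(a, b)`, and distinct points `x n ∈ (a, b)`, `n ∈ idx ⊆ ℤ`, which
have no accumulation point in `(a, b)`. -/
structure SturmData where
  a : EReal
  b : EReal
  a_lt_b : a < b
  V : ℝ → ℝ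
  locallyIntegrable : LocallyIntegrableOn V {y : ℝ | a < y ∧ y < b} volume
  idx : Set ℤ
  x : idx → ℝ
  x_injective : Function.Injective x
  x_mem : ∀ n, a < x n ∧ x n < b
  not_accPt : ∀ y : ℝ, a < y → y < b → ¬ AccPt y (𝓟 (range x))

namespace SturmData

/-- The interval `(a, b)`. -/
def J (S : SturmData) : Set ℝ := {y : ℝ | S.a < y ∧ y < S.b}

/-- The set of interaction points. -/
def M (S : SturmData) : Set ℝ := range S.x

/-- Lebesgue measure on `(a, b)`. -/
def μ (S : SturmData) : Measure ℝ := volume.restrict S.J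

/-- The Hilbert space `L²(a, b)`. -/
abbrev L2 (S : SturmData) : Type := Lp ℂ 2 S.μ

/-- `f` is a solution of `(τ_{Λ,R,Θ} - z) f = g`. -/
structure IsSolution (S : SturmData) (Λ R Θ : S.idx → ℝ) (z : ℂ) (g f : ℝ → ℂ) : Prop where
  ac : LocallyAC₂ f (S.J \ S.M)
  eqn : ∀ᵐ y ∂S.μ, sturmExpr S.V f y - z * f y = g y
  jump : ∀ n, JumpCondition (interactionMatrix (Λ n) (R n) (Θ n)) f (S.x n)

/-- `f` is square integrable near `a` ("lies left in `L²(a, b)`"). -/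
def LiesLeft (S : SturmData) (f : ℝ → ℂ) : Prop :=
  ∃ c ∈ S.J, MemLp f 2 (volume.restrict (S.J ∩ Iio c))

/-- `f` is square integrable near `b` ("lies right in `L²(a, b)`"). -/
def LiesRight (S : SturmData) (f : ℝ → ℂ) : Prop :=
  ∃ c ∈ S.J, MemLp f 2 (volume.restrict (S.J ∩ Ioi c))

/-- `τ_{Λ,R,Θ}` is in the limit point case at `a`. -/
def LimitPointLeft (S : SturmData) (Λ R Θ : S.idx → ℝ) : Prop :=
  ∀ z : ℂ, ∃ f, S.IsSolution Λ R Θ z 0 f ∧ ¬ S.LiesLeft f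

/-- `τ_{Λ,R,Θ}` is in the limit point case at `b`. -/
def LimitPointRight (S : SturmData) (Λ R Θ : S.idx → ℝ) : Prop :=
  ∀ z : ℂ, ∃ f, S.IsSolution Λ R Θ z 0 f ∧ ¬ S.LiesRight f

/-- `τ_{Λ,R,Θ}` is regular at the (finite) left end point `a = a₀`. -/
structure RegularLeftAt (S : SturmData) (a₀ : ℝ) : Prop where
  eq : S.a = a₀
  locallyIntegrable : LocallyIntegrableOn S.V {y : ℝ | S.a ≤ y ∧ y < S.b} volume
  not_accPt : ¬ AccPt a₀ (𝓟 S.M)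

/-- `τ_{Λ,R,Θ}` is regular at the (finite) right end point `b = b₀`. -/
structure RegularRightAt (S : SturmData) (b₀ : ℝ) : Prop where
  eq : S.b = b₀
  locallyIntegrable : LocallyIntegrableOn S.V {y : ℝ | S.a < y ∧ y ≤ S.b} volume
  not_accPt : ¬ AccPt b₀ (𝓟 S.M)

/-- `τ_{Λ,R,Θ}` is regular at `a`. -/
def RegularLeft (S : SturmData) : Prop := ∃ a₀, S.RegularLeftAt a₀

/-- `τ_{Λ,R,Θ}` is regular at `b`. -/
def RegularRight (S : SturmData) : Prop := ∃ b₀, S.RegularRightAt b₀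

/-- `f cos ψ + f' sin ψ = 0` in the limit along the filter `l`, where `f`, `f'` have limits. -/
def BoundaryCondition (ψ : ℝ) (f : ℝ → ℂ) (l : Filter ℝ) : Prop :=
  ∃ p p' : ℂ, Tendsto f l (𝓝 p) ∧ Tendsto (deriv f) l (𝓝 p') ∧
    p * (Real.cos ψ : ℂ) + p' * (Real.sin ψ : ℂ) = 0

/-- The functions in the domain of the maximal operator `T_{Λ,R,Θ}`. -/
structure InMaxDomain (S : SturmData) (Λ R Θ : S.idx → ℝ) (f : ℝ → ℂ) : Prop where
  memLp : MemLp f 2 S.μ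
  ac : LocallyAC₂ f (S.J \ S.M)
  memLp_expr : MemLp (sturmExpr S.V f) 2 S.μ
  jump : ∀ n, JumpCondition (interactionMatrix (Λ n) (R n) (Θ n)) f (S.x n)

/-- The functions in the domain of `H_{Λ,R,Θ}`: at a regular end point the separated
real boundary condition with angle `ψa` (resp. `ψb`) is imposed; at a limit point end point,
which is never regular, there is no boundary condition. -/
structure InDomain (S : SturmData) (ψa ψb : ℝ) (Λ R Θ : S.idx → ℝ) (f : ℝ → ℂ) : Prop where
  max : S.InMaxDomain Λ R Θ f
  left : ∀ a₀, S.RegularLeftAt a₀ → BoundaryCondition ψa f (𝓝[>] a₀)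
  right : ∀ b₀, S.RegularRightAt b₀ → BoundaryCondition ψb f (𝓝[<] b₀)

end SturmData

/-! Closure properties, needed for the operator to be well defined and linear. -/

lemma LocallyAC₂.zero (U : Set ℝ) : LocallyAC₂ 0 U := by
  have h : deriv (0 : ℝ → ℂ) = 0 := by ext y; simp
  have h0 : ∀ c d : ℝ, AbsolutelyContinuousOnInterval (0 : ℝ → ℂ) c d := fun c d => by
    have := (contDiff_const (𝕜 := ℝ) (n := 1) (c := (0 : ℂ)) (E := ℝ)).contDiffOn
      (s := uIcc c d) |>.absolutelyContinuousOnInterval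
    exact this
  exact ⟨fun y _ => differentiableAt_const _, fun c d _ _ => h0 c d,
    fun c d _ _ => by rw [h]; exact h0 c d⟩

lemma AbsolutelyContinuousOnInterval.congr_Icc {f g : ℝ → ℂ} {c d : ℝ} (hcd : c ≤ d)
    (hf : AbsolutelyContinuousOnInterval f c d) (h : EqOn g f (Icc c d)) :
    AbsolutelyContinuousOnInterval g c d := by
  rw [absolutelyContinuousOnInterval_iff] at hf ⊢
  intro ε hε
  obtain ⟨δ, hδ, H⟩ := hf ε hε
  refine ⟨δ, hδ, fun E hE hlt => ?_⟩
  have h2 := H E hE hlt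
  have hmem := hE.1
  rw [uIcc_of_le hcd] at hmem
  rwa [Finset.sum_congr rfl fun i hi => by
    rw [h (hmem i hi).1, h (hmem i hi).2]]

lemma LocallyAC₂.add {f g : ℝ → ℂ} {U : Set ℝ} (hf : LocallyAC₂ f U) (hg : LocallyAC₂ g U) :
    LocallyAC₂ (f + g) U := by
  refine ⟨fun y hy => (hf.1 y hy).add (hg.1 y hy),
    fun c d h h' => (hf.2 c d h h').add (hg.2 c d h h'), fun c d h h' => ?_⟩
  refine ((hf.3 c d h h').add (hg.3 c d h h')).congr_Icc h fun y hy => ?_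
  exact deriv_add (hf.1 y (h' hy)) (hg.1 y (h' hy))

lemma deriv_const_smul_eq (k : ℂ) (f : ℝ → ℂ) : deriv (k • f) = k • deriv f := by
  ext y
  exact deriv_const_smul_field k f

lemma LocallyAC₂.smul {f : ℝ → ℂ} {U : Set ℝ} (k : ℂ) (hf : LocallyAC₂ f U) :
    LocallyAC₂ (k • f) U := by
  refine ⟨fun y hy => (hf.1 y hy).const_smul k,
    fun c d h h' => (hf.2 c d h h').const_smul k, fun c d h h' => ?_⟩
  rw [deriv_const_smul_eq]
  exact (hf.3 c d h h').const_smul k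

lemma LocallyAC₂.ae_differentiableAt {f : ℝ → ℂ} {U : Set ℝ} (hU : IsOpen U)
    (hf : LocallyAC₂ f U) : ∀ᵐ y, y ∈ U → DifferentiableAt ℝ (deriv f) y := by
  rw [ae_iff]
  refine measure_null_of_locally_null _ fun y hy => ?_
  simp only [mem_ofPred_eq, Classical.not_imp] at hy
  obtain ⟨ε, hε, hsub⟩ := Metric.nhds_basis_closedBall.mem_iff.1 (hU.mem_nhds hy.1)
  rw [Real.closedBall_eq_Icc] at hsub
  have hle : y - ε ≤ y + ε := by linarith
  have hae := (hf.3 _ _ hle hsub).boundedVariationOn.ae_differentiableAt_of_mem_uIcc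
  refine ⟨{y | ¬(y ∈ U → DifferentiableAt ℝ (deriv f) y)} ∩ Icc (y - ε) (y + ε),
    inter_mem self_mem_nhdsWithin (mem_nhdsWithin_of_mem_nhds
      (Icc_mem_nhds (by linarith) (by linarith))), ?_⟩
  refine measure_mono_null ?_ (ae_iff.1 hae)
  rintro w ⟨hw, hw'⟩
  simp only [mem_ofPred_eq, Classical.not_imp] at hw ⊢
  exact ⟨by rwa [uIcc_of_le hle], hw.2⟩

lemma LocallyAC₂.deriv_add_eventuallyEq {f g : ℝ → ℂ} {U : Set ℝ} (hf : LocallyAC₂ f U)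
    (hg : LocallyAC₂ g U) {l : Filter ℝ} (hl : U ∈ l) :
    deriv (f + g) =ᶠ[l] deriv f + deriv g := by
  filter_upwards [hl] with y hy
  exact deriv_add (hf.1 y hy) (hg.1 y hy)

lemma JumpCondition.zero (A : Matrix (Fin 2) (Fin 2) ℝ) (p : ℝ) : JumpCondition A 0 p := by
  have h : deriv (0 : ℝ → ℂ) = 0 := by ext y; simp
  refine ⟨0, 0, ?_, ?_, ?_, ?_, by simp⟩
  · exact tendsto_const_nhds
  · rw [h]; exact tendsto_const_nhds
  · exact tendsto_const_nhds
  · rw [h]; exact tendsto_const_nhds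

lemma JumpCondition.add {A : Matrix (Fin 2) (Fin 2) ℝ} {f g : ℝ → ℂ} {p : ℝ} {U : Set ℝ}
    (hf : JumpCondition A f p) (hg : JumpCondition A g p)
    (hf' : LocallyAC₂ f U) (hg' : LocallyAC₂ g U) (hU : U ∈ 𝓝[≠] p) :
    JumpCondition A (f + g) p := by
  obtain ⟨l, r, h1, h2, h3, h4, h5⟩ := hf
  obtain ⟨l', r', h1', h2', h3', h4', h5'⟩ := hg
  have hl : U ∈ 𝓝[<] p := nhdsWithin_mono p (fun y hy => ne_of_lt hy) hU
  have hr : U ∈ 𝓝[>] p := nhdsWithin_mono p (fun y hy => ne_of_gt hy) hU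
  exact ⟨l + l', r + r', h1.add h1',
    (h2.add h2').congr' (hf'.deriv_add_eventuallyEq hg' hl).symm, h3.add h3',
    (h4.add h4').congr' (hf'.deriv_add_eventuallyEq hg' hr).symm,
    by rw [Matrix.mulVec_add, h5, h5']⟩

lemma JumpCondition.smul {A : Matrix (Fin 2) (Fin 2) ℝ} {f : ℝ → ℂ} {p : ℝ} (k : ℂ)
    (hf : JumpCondition A f p) : JumpCondition A (k • f) p := by
  obtain ⟨l, r, h1, h2, h3, h4, h5⟩ := hf
  refine ⟨k • l, k • r, h1.const_smul k, ?_, h3.const_smul k, ?_, ?_⟩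
  · rw [deriv_const_smul_eq]; exact h2.const_smul k
  · rw [deriv_const_smul_eq]; exact h4.const_smul k
  · rw [Matrix.mulVec_smul, h5]

namespace SturmData

lemma BoundaryCondition.zero (ψ : ℝ) (l : Filter ℝ) : BoundaryCondition ψ 0 l := by
  have h : deriv (0 : ℝ → ℂ) = 0 := by ext y; simp
  refine ⟨0, 0, tendsto_const_nhds, ?_, by simp⟩
  rw [h]; exact tendsto_const_nhds

lemma BoundaryCondition.add {ψ : ℝ} {f g : ℝ → ℂ} {l : Filter ℝ} {U : Set ℝ}
    (hf : BoundaryCondition ψ f l) (hg : BoundaryCondition ψ g l)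
    (hf' : LocallyAC₂ f U) (hg' : LocallyAC₂ g U) (hU : U ∈ l) :
    BoundaryCondition ψ (f + g) l := by
  obtain ⟨p, p', h1, h2, h3⟩ := hf
  obtain ⟨q, q', k1, k2, k3⟩ := hg
  refine ⟨p + q, p' + q', h1.add k1,
    (h2.add k2).congr' (hf'.deriv_add_eventuallyEq hg' hU).symm, ?_⟩
  linear_combination h3 + k3

lemma BoundaryCondition.smul {ψ : ℝ} {f : ℝ → ℂ} {l : Filter ℝ} (k : ℂ)
    (hf : BoundaryCondition ψ f l) : BoundaryCondition ψ (k • f) l := by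
  obtain ⟨p, p', h1, h2, h3⟩ := hf
  refine ⟨k * p, k * p', h1.const_smul k, ?_, by linear_combination k * h3⟩
  rw [deriv_const_smul_eq]; exact h2.const_smul k

variable (S : SturmData)

lemma isOpen_J : IsOpen S.J :=
  (isOpen_lt continuous_const continuous_coe_real_ereal).inter
    (isOpen_lt continuous_coe_real_ereal continuous_const)

lemma compl_M_mem {y : ℝ} (h : ¬ AccPt y (𝓟 S.M)) : S.Mᶜ ∈ 𝓝[≠] y := by
  rw [AccPt, neBot_iff, not_not, inf_principal_eq_bot] at h
  exact h

lemma diff_mem_punctured {y : ℝ} (hy : y ∈ S.J) : S.J \ S.M ∈ 𝓝[≠] y :=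
  inter_mem (mem_nhdsWithin_of_mem_nhds (S.isOpen_J.mem_nhds hy))
    (S.compl_M_mem (S.not_accPt y hy.1 hy.2))

lemma isOpen_diff : IsOpen (S.J \ S.M) := by
  rw [isOpen_iff_mem_nhds]
  intro y hy
  have h := S.diff_mem_punctured hy.1
  rw [mem_nhdsWithin_iff_eventually] at h
  filter_upwards [h] with w hw
  by_cases hwy : w = y
  · rwa [hwy]
  · exact hw hwy

lemma ae_mem_diff : ∀ᵐ y ∂S.μ, y ∈ S.J \ S.M := by
  have h1 : ∀ᵐ y ∂S.μ, y ∈ S.J := ae_restrict_mem S.isOpen_J.measurableSet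
  have h2 : ∀ᵐ y ∂S.μ, y ∉ S.M := ae_restrict_of_ae ((countable_range S.x).ae_notMem volume)
  filter_upwards [h1, h2] with y hy hy' using ⟨hy, hy'⟩

variable {S}

lemma RegularLeftAt.mem {a₀ : ℝ} (h : S.RegularLeftAt a₀) : S.J \ S.M ∈ 𝓝[>] a₀ := by
  refine inter_mem ?_ (nhdsWithin_mono a₀ (fun y hy => ne_of_gt hy) (S.compl_M_mem h.not_accPt))
  have hb : {y : ℝ | (y : EReal) < S.b} ∈ 𝓝[>] a₀ :=
    mem_nhdsWithin_of_mem_nhds ((isOpen_lt continuous_coe_real_ereal continuous_const).mem_nhds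
      (by have := S.a_lt_b; rwa [h.eq] at this))
  filter_upwards [hb, self_mem_nhdsWithin] with y hy hy'
  exact ⟨by rw [h.eq]; exact_mod_cast hy', hy⟩

lemma RegularRightAt.mem {b₀ : ℝ} (h : S.RegularRightAt b₀) : S.J \ S.M ∈ 𝓝[<] b₀ := by
  refine inter_mem ?_ (nhdsWithin_mono b₀ (fun y hy => ne_of_lt hy) (S.compl_M_mem h.not_accPt))
  have hb : {y : ℝ | S.a < (y : EReal)} ∈ 𝓝[<] b₀ :=
    mem_nhdsWithin_of_mem_nhds ((isOpen_lt continuous_const continuous_coe_real_ereal).mem_nhds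
      (by have := S.a_lt_b; rwa [h.eq] at this))
  filter_upwards [hb, self_mem_nhdsWithin] with y hy hy'
  exact ⟨hy, by rw [h.eq]; exact_mod_cast hy'⟩

lemma expr_add {f g : ℝ → ℂ} (hf : LocallyAC₂ f (S.J \ S.M)) (hg : LocallyAC₂ g (S.J \ S.M)) :
    sturmExpr S.V (f + g) =ᵐ[S.μ] sturmExpr S.V f + sturmExpr S.V g := by
  filter_upwards [S.ae_mem_diff, ae_restrict_of_ae (hf.ae_differentiableAt S.isOpen_diff),
    ae_restrict_of_ae (hg.ae_differentiableAt S.isOpen_diff)] with y hy h1 h2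
  have h3 : deriv (deriv (f + g)) y = deriv (deriv f) y + deriv (deriv g) y := by
    rw [(hf.deriv_add_eventuallyEq hg (S.isOpen_diff.mem_nhds hy)).deriv_eq]
    exact deriv_add (h1 hy) (h2 hy)
  simp only [sturmExpr, Pi.add_apply, h3]
  ring

lemma expr_smul (k : ℂ) (f : ℝ → ℂ) : sturmExpr S.V (k • f) = k • sturmExpr S.V f := by
  ext y
  simp only [sturmExpr, deriv_const_smul_eq, Pi.smul_apply, smul_eq_mul]
  ring

lemma expr_congr {f g : ℝ → ℂ} (hf : LocallyAC₂ f (S.J \ S.M)) (hg : LocallyAC₂ g (S.J \ S.M))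
    (h : f =ᵐ[S.μ] g) : sturmExpr S.V f =ᵐ[S.μ] sturmExpr S.V g := by
  have hU := S.isOpen_diff
  have h' : f =ᵐ[volume.restrict (S.J \ S.M)] g := ae_restrict_of_ae_restrict_of_subset
    sdiff_subset h
  have heq : EqOn f g (S.J \ S.M) := Measure.eqOn_open_of_ae_eq h' hU
    (fun y hy => (hf.1 y hy).continuousAt.continuousWithinAt)
    (fun y hy => (hg.1 y hy).continuousAt.continuousWithinAt)
  filter_upwards [S.ae_mem_diff] with y hy
  have e : f =ᶠ[𝓝 y] g := heq.eventuallyEq_of_mem (hU.mem_nhds hy)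
  simp only [sturmExpr, e.deriv.deriv_eq, heq hy]

variable {ψa ψb : ℝ} {Λ R Θ : S.idx → ℝ}

lemma InDomain.zero : S.InDomain ψa ψb Λ R Θ 0 := by
  refine ⟨⟨MemLp.zero', LocallyAC₂.zero _, ?_, fun n => JumpCondition.zero _ _⟩,
    fun _ _ => BoundaryCondition.zero _ _, fun _ _ => BoundaryCondition.zero _ _⟩
  have h : deriv (0 : ℝ → ℂ) = 0 := by ext y; simp
  have h0 : sturmExpr S.V 0 = 0 := by
    ext y
    simp [sturmExpr, h]
  rw [h0]; exact MemLp.zero'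

lemma InDomain.add {f g : ℝ → ℂ} (hf : S.InDomain ψa ψb Λ R Θ f)
    (hg : S.InDomain ψa ψb Λ R Θ g) : S.InDomain ψa ψb Λ R Θ (f + g) :=
  ⟨⟨hf.max.memLp.add hg.max.memLp, hf.max.ac.add hg.max.ac,
    (hf.max.memLp_expr.add hg.max.memLp_expr).ae_eq (expr_add hf.max.ac hg.max.ac).symm,
    fun n => (hf.max.jump n).add (hg.max.jump n) hf.max.ac hg.max.ac
      (S.diff_mem_punctured (S.x_mem n))⟩,
    fun a₀ h => (hf.left a₀ h).add (hg.left a₀ h) hf.max.ac hg.max.ac h.mem,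
    fun b₀ h => (hf.right b₀ h).add (hg.right b₀ h) hf.max.ac hg.max.ac h.mem⟩

lemma InDomain.smul {f : ℝ → ℂ} (k : ℂ) (hf : S.InDomain ψa ψb Λ R Θ f) :
    S.InDomain ψa ψb Λ R Θ (k • f) :=
  ⟨⟨hf.max.memLp.const_smul k, hf.max.ac.smul k,
    by rw [expr_smul]; exact hf.max.memLp_expr.const_smul k, fun n => (hf.max.jump n).smul k⟩,
    fun a₀ h => (hf.left a₀ h).smul k, fun b₀ h => (hf.right b₀ h).smul k⟩

variable (S ψa ψb Λ R Θ)

/-- The domain `D(H_{Λ,R,Θ})`, as a subspace of `L²(a, b)`: the classes that have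
a representative satisfying the conditions of the domain. -/
def domain : Submodule ℂ S.L2 where
  carrier := {φ | ∃ f, S.InDomain ψa ψb Λ R Θ f ∧ φ =ᵐ[S.μ] f}
  zero_mem' := ⟨0, InDomain.zero, Lp.coeFn_zero _ _ _⟩
  add_mem' := by
    rintro φ χ ⟨f, hf, hφ⟩ ⟨g, hg, hχ⟩
    exact ⟨f + g, hf.add hg, (Lp.coeFn_add φ χ).trans (hφ.add hχ)⟩
  smul_mem' := by
    rintro k φ ⟨f, hf, hφ⟩
    exact ⟨k • f, hf.smul k, (Lp.coeFn_smul k φ).trans (hφ.const_smul k)⟩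

/-- A representative of an element of the domain. -/
def rep (φ : S.domain ψa ψb Λ R Θ) : ℝ → ℂ := φ.2.choose

lemma rep_inDomain (φ : S.domain ψa ψb Λ R Θ) :
    S.InDomain ψa ψb Λ R Θ (S.rep ψa ψb Λ R Θ φ) := φ.2.choose_spec.1

lemma coe_ae_eq_rep (φ : S.domain ψa ψb Λ R Θ) :
    (φ : S.L2) =ᵐ[S.μ] S.rep ψa ψb Λ R Θ φ := φ.2.choose_spec.2

/-- The operator `H_{Λ,R,Θ}` in `L²(a, b)`: `H φ = τ f` for every (equivalently, some)
representative `f` of `φ` that satisfies the conditions of the domain. -/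
def hamiltonian : S.L2 →ₗ.[ℂ] S.L2 where
  domain := S.domain ψa ψb Λ R Θ
  toFun :=
    { toFun := fun φ => (S.rep_inDomain ψa ψb Λ R Θ φ).max.memLp_expr.toLp _
      map_add' := by
        intro φ χ
        have hφ := S.rep_inDomain ψa ψb Λ R Θ φ
        have hχ := S.rep_inDomain ψa ψb Λ R Θ χ
        have hs := S.rep_inDomain ψa ψb Λ R Θ (φ + χ)
        rw [← MemLp.toLp_add, MemLp.toLp_eq_toLp_iff]
        refine (expr_congr hs.max.ac (hφ.max.ac.add hχ.max.ac) ?_).trans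
          (expr_add hφ.max.ac hχ.max.ac)
        exact (S.coe_ae_eq_rep ψa ψb Λ R Θ (φ + χ)).symm.trans
          ((Lp.coeFn_add (φ : S.L2) (χ : S.L2)).trans
            ((S.coe_ae_eq_rep ψa ψb Λ R Θ φ).add (S.coe_ae_eq_rep ψa ψb Λ R Θ χ)))
      map_smul' := by
        intro k φ
        have hφ := S.rep_inDomain ψa ψb Λ R Θ φ
        have hs := S.rep_inDomain ψa ψb Λ R Θ (k • φ)
        rw [RingHom.id_apply, ← MemLp.toLp_const_smul, MemLp.toLp_eq_toLp_iff, ← expr_smul]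
        refine expr_congr hs.max.ac (hφ.max.ac.smul k) ?_
        exact (S.coe_ae_eq_rep ψa ψb Λ R Θ (k • φ)).symm.trans
          ((Lp.coeFn_smul k (φ : S.L2)).trans
            ((S.coe_ae_eq_rep ψa ψb Λ R Θ φ).const_smul k)) }

/-- The value of the operator does not depend on the representative. -/
lemma hamiltonian_ae_eq (φ : (S.hamiltonian ψa ψb Λ R Θ).domain) {f : ℝ → ℂ}
    (hf : S.InDomain ψa ψb Λ R Θ f) (h : (φ : S.L2) =ᵐ[S.μ] f) :
    S.hamiltonian ψa ψb Λ R Θ φ =ᵐ[S.μ] sturmExpr S.V f :=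
  (MemLp.coeFn_toLp (S.rep_inDomain ψa ψb Λ R Θ φ).max.memLp_expr).trans
    (expr_congr (S.rep_inDomain ψa ψb Λ R Θ φ).max.ac hf.max.ac
      ((S.coe_ae_eq_rep ψa ψb Λ R Θ φ).symm.trans h))

end SturmData

end

/-!
Suppose that `E` is an eigenvalue of both `H_Θ` and `H_Θ'`, where `Θ` and `Θ'` differ only at `n₀`,
with eigenfunctions `f` and `g`, and write `W(f, g) = f g' - f' g`. On each side of `x_{n₀}` both
functions solve the same equation; there Wronskians are constant and, by the limit point or boundary
condition at the endpoint, zero. As `E` and the coefficients are real, this applies to `g` and to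
its conjugate `ḡ`: `W(f, g)` and `W(f, ḡ)` vanish at `x_{n₀}-`, and `W(f, ḡ)` vanishes at `x_{n₀}+`.
The first identity makes the Cauchy data of `f` and `g` at `x_{n₀}-` proportional, and the other two
then give `sin (θ'_{n₀} - θ_{n₀}) = 0`. Hence, all other angles being fixed, `E` is an eigenvalue
for only countably many values of `θ_{n₀}`, and Fubini's theorem applies, because drawing the
coordinate `n₀` anew does not change the product measure.
-/

/-! ### Absolute continuity and Gronwall's inequality -/

theorem absolutelyContinuousOnInterval_comp_of_lipschitzOnWith {X Y : Type*} [PseudoMetricSpace X]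
    [PseudoMetricSpace Y] {K : NNReal} {φ : X → Y} {s : Set X} {f : ℝ → X} {c d : ℝ}
    (hφ : LipschitzOnWith K φ s) (hf : AbsolutelyContinuousOnInterval f c d)
    (hs : MapsTo f (uIcc c d) s) : AbsolutelyContinuousOnInterval (φ ∘ f) c d := by
  have hsum := Filter.Tendsto.const_mul (K : ℝ) hf
  rw [mul_zero] at hsum
  refine squeeze_zero' (.of_forall fun _ => Finset.sum_nonneg fun _ _ => dist_nonneg) ?_ hsum
  filter_upwards [mem_inf_of_right (mem_principal_self _)] with I hI
  rw [Finset.mul_sum]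
  exact Finset.sum_le_sum fun i hi =>
    hφ.dist_le_mul _ (hs (hI.1 i hi).1) _ (hs (hI.1 i hi).2)

theorem absolutelyContinuousOnInterval_norm {E : Type*} [SeminormedAddCommGroup E] {f : ℝ → E}
    {c d : ℝ} (hf : AbsolutelyContinuousOnInterval f c d) :
    AbsolutelyContinuousOnInterval (fun y => ‖f y‖) c d :=
  absolutelyContinuousOnInterval_comp_of_lipschitzOnWith lipschitzWith_one_norm.lipschitzOnWith hf
    (mapsTo_univ _ _)

theorem absolutelyContinuousOnInterval_star {E : Type*} [SeminormedAddCommGroup E]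
    [StarAddMonoid E] [NormedStarGroup E] {f : ℝ → E} {c d : ℝ}
    (hf : AbsolutelyContinuousOnInterval f c d) :
    AbsolutelyContinuousOnInterval (fun y => star (f y)) c d :=
  absolutelyContinuousOnInterval_comp_of_lipschitzOnWith
    (LipschitzWith.of_dist_le' (K := 1) fun x y => by simp).lipschitzOnWith hf
    (mapsTo_univ _ _)

theorem absolutelyContinuousOnInterval_comp_of_contDiff {φ f : ℝ → ℝ} {c d : ℝ}
    (hφ : ContDiff ℝ 1 φ) (hf : AbsolutelyContinuousOnInterval f c d) :
    AbsolutelyContinuousOnInterval (φ ∘ f) c d := by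
  obtain ⟨C, hC⟩ := hf.exists_bound
  obtain ⟨K, hK⟩ := hφ.contDiffOn.exists_lipschitzOnWith one_ne_zero (convex_closedBall (0 : ℝ) C)
    (isCompact_closedBall 0 C)
  exact absolutelyContinuousOnInterval_comp_of_lipschitzOnWith hK hf fun x hx =>
    mem_closedBall_zero_iff.2 (hC x hx)

theorem le_of_ae_deriv_nonpos {F : ℝ → ℝ} {c d : ℝ} (hcd : c ≤ d)
    (hF : AbsolutelyContinuousOnInterval F c d)
    (hF' : ∀ᵐ x, x ∈ Icc c d → deriv F x ≤ 0) : F d ≤ F c := by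
  rw [← sub_nonpos, ← hF.integral_deriv_eq_sub, intervalIntegral.integral_of_le hcd]
  refine setIntegral_nonpos_ae measurableSet_Ioc ?_
  filter_upwards [hF'] with x hx hx' using hx (Ioc_subset_Icc_self hx')

theorem le_exp_integral_mul_of_ae_deriv_le {F k : ℝ → ℝ} {c d : ℝ} (hcd : c ≤ d)
    (hF : AbsolutelyContinuousOnInterval F c d) (hk : IntervalIntegrable k volume c d)
    (hF' : ∀ᵐ x, x ∈ Icc c d → deriv F x ≤ k x * F x) :
    F d ≤ Real.exp (∫ x in c..d, k x) * F c := by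
  let e : ℝ → ℝ := fun x => Real.exp (-∫ t in c..x, k t)
  have he : AbsolutelyContinuousOnInterval e c d :=
    absolutelyContinuousOnInterval_comp_of_contDiff (φ := fun u => Real.exp (-u))
      (Real.contDiff_exp.comp contDiff_neg)
      (hk.absolutelyContinuousOnInterval_intervalIntegral left_mem_uIcc)
  have hle : e d * F d ≤ e c * F c := by
    refine le_of_ae_deriv_nonpos (F := e * F) hcd (he.mul hF) ?_
    filter_upwards [hF', hF.ae_differentiableAt, hk.ae_hasDerivAt_integral]
      with x hx hFx hkx hxI
    have hxI' : x ∈ uIcc c d := Icc_subset_uIcc hxI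
    have hderiv : HasDerivAt (e * F) (e x * -k x * F x + e x * deriv F x) x :=
      (hkx hxI' c left_mem_uIcc).fun_neg.exp.mul (hFx hxI').hasDerivAt
    rw [hderiv.deriv]
    linarith [mul_le_mul_of_nonneg_left (hx hxI) (Real.exp_nonneg (-∫ t in c..x, k t))]
  have hec : e c = 1 := by simp only [e, intervalIntegral.integral_same, neg_zero, Real.exp_zero]
  rw [hec, one_mul] at hle
  rw [← inv_mul_le_iff₀ (Real.exp_pos _), ← Real.exp_neg]
  exact hle

theorem le_exp_integral_mul_of_ae_abs_deriv_le {F k : ℝ → ℝ} {s t : ℝ}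
    (hF : AbsolutelyContinuousOnInterval F s t) (hk : IntervalIntegrable k volume s t)
    (hF' : ∀ᵐ x, x ∈ uIcc s t → |deriv F x| ≤ k x * F x) :
    F t ≤ Real.exp (∫ x in uIoc s t, k x) * F s := by
  rcases le_total s t with hst | hts
  · rw [uIoc_of_le hst, ← intervalIntegral.integral_of_le hst]
    rw [uIcc_of_le hst] at hF'
    exact le_exp_integral_mul_of_ae_deriv_le hst hF hk
      (hF'.mono fun x hx hxI => (le_abs_self _).trans (hx hxI))
  · rw [uIoc_of_ge hts, ← intervalIntegral.integral_of_le hts]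
    rw [uIcc_of_ge hts] at hF'
    have hneg := le_exp_integral_mul_of_ae_deriv_le (F := -F) (k := -k) hts hF.symm.neg
      hk.symm.neg (hF'.mono fun x hx hxI => by
        rw [deriv.neg, Pi.neg_apply, Pi.neg_apply, neg_mul_neg]
        exact (neg_le_abs _).trans (hx hxI))
    simp only [Pi.neg_apply, intervalIntegral.integral_neg, Real.exp_neg, mul_neg,
      neg_le_neg_iff] at hneg
    exact (inv_mul_le_iff₀ (Real.exp_pos _)).1 hneg

/-! ### The symplectic form on the plane and the interaction matrices -/

open scoped Matrix

/-- The standard symplectic form `u₀ v₁ - u₁ v₀`. The Wronskian of two functions is the form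
evaluated at their Cauchy data. -/
def symplecticForm {𝕜 : Type*} [CommRing 𝕜] (u v : Fin 2 → 𝕜) : 𝕜 := u 0 * v 1 - u 1 * v 0

section CommRing

variable {𝕜 : Type*} [CommRing 𝕜]

theorem symplecticForm_mulVec (A : Matrix (Fin 2) (Fin 2) 𝕜) (u v : Fin 2 → 𝕜) :
    symplecticForm (A *ᵥ u) (A *ᵥ v) = A.det * symplecticForm u v := by
  simp only [symplecticForm, Matrix.mulVec, dotProduct, Fin.sum_univ_two, Matrix.det_fin_two]
  ring

theorem symplecticForm_smul_eq_add (u v w : Fin 2 → 𝕜) :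
    symplecticForm u v • w = symplecticForm w v • u + symplecticForm u w • v := by
  ext i
  fin_cases i <;> simp [symplecticForm] <;> ring

theorem dotProduct_smul_sub_dotProduct_smul (u v w : Fin 2 → 𝕜) :
    (u ⬝ᵥ w) • v - (v ⬝ᵥ w) • u = symplecticForm u v • ![-w 1, w 0] := by
  ext i
  fin_cases i <;> simp [symplecticForm, dotProduct, Fin.sum_univ_two] <;> ring

theorem symplecticForm_eq_zero_of_annihilated {u v : Fin 2 → 𝕜} {c s : 𝕜}
    (hcs : c ^ 2 + s ^ 2 = 1) (hu : u 0 * c + u 1 * s = 0) (hv : v 0 * c + v 1 * s = 0) :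
    symplecticForm u v = 0 := by
  simp only [symplecticForm]
  linear_combination (-(u 0 * v 1 - u 1 * v 0)) * hcs + (c * v 1 - s * v 0) * hu -
    (c * u 1 - s * u 0) * hv

end CommRing

open scoped ComplexOrder in
theorem dotProduct_star_ne_zero_of_symplecticForm_eq_zero {u v : Fin 2 → ℂ} (hu : u ≠ 0)
    (hv : v ≠ 0) (h : symplecticForm u v = 0) : u ⬝ᵥ star v ≠ 0 := by
  intro huv
  have hvv : (v ⬝ᵥ star v) • u = 0 := by
    simpa [h, huv] using dotProduct_smul_sub_dotProduct_smul u v (star v)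
  exact (smul_ne_zero (mt dotProduct_self_star_eq_zero.1 hv) hu) hvv

/-- The action of a real matrix on `ℂ²`, in the form in which it occurs in `JumpCondition`. -/
abbrev complexify (A : Matrix (Fin 2) (Fin 2) ℝ) : Matrix (Fin 2) (Fin 2) ℂ :=
  A.map (fun t : ℝ => (t : ℂ))

theorem det_complexify (A : Matrix (Fin 2) (Fin 2) ℝ) : (complexify A).det = (A.det : ℂ) :=
  (RingHom.map_det Complex.ofRealHom A).symm

theorem complexify_mul (A B : Matrix (Fin 2) (Fin 2) ℝ) :
    complexify (A * B) = complexify A * complexify B :=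
  Matrix.map_mul (f := Complex.ofRealHom)

theorem star_complexify_mulVec (A : Matrix (Fin 2) (Fin 2) ℝ) (u : Fin 2 → ℂ) :
    star (complexify A *ᵥ u) = complexify A *ᵥ star u := by
  ext i
  simp only [Matrix.mulVec, dotProduct, Fin.sum_univ_two, Matrix.map_apply, Pi.star_apply,
    star_add, star_mul', Complex.star_def, Complex.conj_ofReal]

theorem symplecticForm_complexify_mulVec {A : Matrix (Fin 2) (Fin 2) ℝ} (hA : A.det = 1)
    (u v : Fin 2 → ℂ) :
    symplecticForm (complexify A *ᵥ u) (complexify A *ᵥ v) = symplecticForm u v := by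
  rw [symplecticForm_mulVec, det_complexify, hA, Complex.ofReal_one, one_mul]

theorem symplecticForm_ellipticMatrix_mulVec (θ : ℝ) (u v : Fin 2 → ℂ) :
    symplecticForm u (complexify (ellipticMatrix θ) *ᵥ v) =
      Real.cos θ * symplecticForm u v + Real.sin θ * (u ⬝ᵥ v) := by
  simp only [symplecticForm, ellipticMatrix, Matrix.mulVec, dotProduct, Fin.sum_univ_two,
    Matrix.map_apply, Matrix.of_apply, Matrix.cons_val', Matrix.cons_val_zero,
    Matrix.cons_val_one, Matrix.cons_val_fin_one]
  push_cast
  ring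

theorem det_interactionMatrix (α θ : ℝ) {r : ℝ} (hr : r ≠ 0) :
    (interactionMatrix α r θ).det = 1 := by
  simp only [interactionMatrix, Matrix.det_mul, parabolicMatrix, hyperbolicMatrix, ellipticMatrix,
    Matrix.det_fin_two_of]
  field_simp
  linear_combination Real.sin_sq_add_cos_sq θ

theorem interactionMatrix_eq_mul_ellipticMatrix (α r θ θ' : ℝ) :
    interactionMatrix α r θ' = interactionMatrix α r θ * ellipticMatrix (θ' - θ) := by
  have hadd : ellipticMatrix θ' = ellipticMatrix θ * ellipticMatrix (θ' - θ) := by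
    obtain ⟨t, rfl⟩ : ∃ t, θ' = θ + t := ⟨θ' - θ, by ring⟩
    ext i j
    fin_cases i <;> fin_cases j <;>
      simp [ellipticMatrix, Real.cos_add, Real.sin_add] <;> ring
  rw [interactionMatrix, interactionMatrix, hadd, Matrix.mul_assoc _ (ellipticMatrix θ)]

/-- With the common factor `interactionMatrix α r θ` removed, `hjump` reads
`sin (θ' - θ) * (l ⬝ᵥ star m) = 0`. -/
theorem sin_sub_eq_zero_of_symplecticForm_eq_zero {α r θ θ' : ℝ} (hr : r ≠ 0) {l m : Fin 2 → ℂ}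
    (hl : l ≠ 0) (hm : m ≠ 0) (hlm : symplecticForm l m = 0)
    (hlm_star : symplecticForm l (star m) = 0)
    (hjump : symplecticForm (complexify (interactionMatrix α r θ) *ᵥ l)
      (complexify (interactionMatrix α r θ') *ᵥ star m) = 0) :
    Real.sin (θ' - θ) = 0 := by
  rw [interactionMatrix_eq_mul_ellipticMatrix α r θ θ', complexify_mul, ← Matrix.mulVec_mulVec,
    symplecticForm_complexify_mulVec (det_interactionMatrix α θ hr),
    symplecticForm_ellipticMatrix_mulVec, hlm_star, mul_zero, zero_add, mul_eq_zero] at hjump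
  exact_mod_cast hjump.resolve_right
    (dotProduct_star_ne_zero_of_symplecticForm_eq_zero hl hm hlm)

/-! ### Cauchy data and the Wronskian -/

/-- The Cauchy data `(f y, f' y)`. -/
noncomputable def cauchyData (f : ℝ → ℂ) (y : ℝ) : Fin 2 → ℂ := ![f y, deriv f y]

/-- The Wronskian `f g' - f' g`. -/
noncomputable def wronskian (f g : ℝ → ℂ) (y : ℝ) : ℂ :=
  symplecticForm (cauchyData f y) (cauchyData g y)

theorem cauchyData_star (f : ℝ → ℂ) (y : ℝ) : cauchyData (star f) y = star (cauchyData f y) := by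
  have hderiv : deriv (star f) = star (deriv f) := deriv.star'
  ext i
  fin_cases i <;> simp [cauchyData, hderiv]

theorem tendsto_cauchyData_iff {f : ℝ → ℂ} {F : Filter ℝ} {u : Fin 2 → ℂ} :
    Tendsto (cauchyData f) F (𝓝 u) ↔
      Tendsto f F (𝓝 (u 0)) ∧ Tendsto (deriv f) F (𝓝 (u 1)) := by
  rw [tendsto_pi_nhds, Fin.forall_fin_two]
  rfl

theorem tendsto_cauchyData_star {f : ℝ → ℂ} {F : Filter ℝ} {u : Fin 2 → ℂ}
    (hf : Tendsto (cauchyData f) F (𝓝 u)) : Tendsto (cauchyData (star f)) F (𝓝 (star u)) := by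
  simp only [funext (cauchyData_star f)]
  exact hf.star

theorem tendsto_wronskian {f g : ℝ → ℂ} {F : Filter ℝ} {u v : Fin 2 → ℂ}
    (hf : Tendsto (cauchyData f) F (𝓝 u)) (hg : Tendsto (cauchyData g) F (𝓝 v)) :
    Tendsto (wronskian f g) F (𝓝 (symplecticForm u v)) := by
  have hf' := tendsto_pi_nhds.1 hf
  have hg' := tendsto_pi_nhds.1 hg
  exact ((hf' 0).mul (hg' 1)).sub ((hf' 1).mul (hg' 0))

theorem jumpCondition_iff {A : Matrix (Fin 2) (Fin 2) ℝ} {f : ℝ → ℂ} {p : ℝ} :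
    JumpCondition A f p ↔ ∃ l, Tendsto (cauchyData f) (𝓝[<] p) (𝓝 l) ∧
      Tendsto (cauchyData f) (𝓝[>] p) (𝓝 (complexify A *ᵥ l)) := by
  simp only [JumpCondition, tendsto_cauchyData_iff, and_assoc]
  refine exists_congr fun l => ⟨?_, fun h => ⟨_, h.1, h.2.1, h.2.2.1, h.2.2.2, rfl⟩⟩
  rintro ⟨_, hl0, hl1, hr0, hr1, rfl⟩
  exact ⟨hl0, hl1, hr0, hr1⟩

theorem JumpCondition.star {A : Matrix (Fin 2) (Fin 2) ℝ} {f : ℝ → ℂ} {p : ℝ}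
    (hf : JumpCondition A f p) : JumpCondition A (star f) p := by
  obtain ⟨l, hl, hr⟩ := jumpCondition_iff.1 hf
  refine jumpCondition_iff.2 ⟨Star.star l, tendsto_cauchyData_star hl, ?_⟩
  rw [← star_complexify_mulVec]
  exact tendsto_cauchyData_star hr

theorem boundaryCondition_iff {ψ : ℝ} {f : ℝ → ℂ} {F : Filter ℝ} :
    SturmData.BoundaryCondition ψ f F ↔ ∃ u, Tendsto (cauchyData f) F (𝓝 u) ∧
      u 0 * (Real.cos ψ : ℂ) + u 1 * (Real.sin ψ : ℂ) = 0 := by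
  simp only [tendsto_cauchyData_iff, and_assoc]
  exact ⟨fun ⟨p, p', h⟩ => ⟨![p, p'], h⟩, fun ⟨u, h⟩ => ⟨u 0, u 1, h⟩⟩

theorem SturmData.BoundaryCondition.star {ψ : ℝ} {f : ℝ → ℂ} {F : Filter ℝ}
    (hf : BoundaryCondition ψ f F) : BoundaryCondition ψ (star f) F := by
  obtain ⟨u, hu, hψ⟩ := boundaryCondition_iff.1 hf
  refine boundaryCondition_iff.2 ⟨Star.star u, tendsto_cauchyData_star hu, ?_⟩
  simpa only [Pi.star_apply, star_add, star_mul', Complex.star_def, Complex.conj_ofReal, star_zero]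
    using congrArg Star.star hψ

theorem SturmData.BoundaryCondition.tendsto_wronskian_zero {ψ : ℝ} {f g : ℝ → ℂ} {F : Filter ℝ}
    (hf : BoundaryCondition ψ f F) (hg : BoundaryCondition ψ g F) :
    Tendsto (wronskian f g) F (𝓝 0) := by
  obtain ⟨u, hu, huψ⟩ := boundaryCondition_iff.1 hf
  obtain ⟨v, hv, hvψ⟩ := boundaryCondition_iff.1 hg
  have hcs : (Real.cos ψ : ℂ) ^ 2 + (Real.sin ψ : ℂ) ^ 2 = 1 := by
    exact_mod_cast Real.cos_sq_add_sin_sq ψ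
  rw [← symplecticForm_eq_zero_of_annihilated hcs huψ hvψ]
  exact tendsto_wronskian hu hv

/-! ### Solutions of `u'' = Q u` on an open set -/

/-- The squared Euclidean norm of the Cauchy data. -/
noncomputable def energy (f : ℝ → ℂ) (y : ℝ) : ℝ := ‖f y‖ ^ 2 + ‖deriv f y‖ ^ 2

theorem energy_nonneg (f : ℝ → ℂ) (y : ℝ) : 0 ≤ energy f y := by
  unfold energy
  positivity

theorem energy_eq_zero_iff {f : ℝ → ℂ} {y : ℝ} : energy f y = 0 ↔ cauchyData f y = 0 := by
  rw [energy, add_eq_zero_iff_of_nonneg (sq_nonneg _) (sq_nonneg _), sq_eq_zero_iff,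
    sq_eq_zero_iff, norm_eq_zero, norm_eq_zero, funext_iff, Fin.forall_fin_two]
  rfl

theorem tendsto_energy_zero {f : ℝ → ℂ} {F : Filter ℝ}
    (hf : Tendsto (cauchyData f) F (𝓝 0)) : Tendsto (energy f) F (𝓝 0) := by
  obtain ⟨hf, hf'⟩ := tendsto_cauchyData_iff.1 hf
  have hsum := (hf.norm.pow 2).add (hf'.norm.pow 2)
  simp only [Pi.zero_apply, norm_zero, ne_eq, OfNat.ofNat_ne_zero, not_false_eq_true, zero_pow,
    add_zero] at hsum
  exact hsum

namespace LocallyAC₂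

variable {f g : ℝ → ℂ} {Q : ℝ → ℂ} {U T : Set ℝ} {s t : ℝ}

theorem mono {U' : Set ℝ} (hf : LocallyAC₂ f U) (h : U' ⊆ U) : LocallyAC₂ f U' :=
  ⟨fun y hy => hf.differentiableAt y (h hy), fun c d hcd hU => hf.ac c d hcd (hU.trans h),
    fun c d hcd hU => hf.ac_deriv c d hcd (hU.trans h)⟩

theorem absolutelyContinuousOnInterval (hf : LocallyAC₂ f U) (hst : uIcc s t ⊆ U) :
    AbsolutelyContinuousOnInterval f s t := by
  rcases le_total s t with h | h
  · exact hf.ac s t h (uIcc_of_le h ▸ hst)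
  · exact (hf.ac t s h (uIcc_of_ge h ▸ hst)).symm

theorem absolutelyContinuousOnInterval_deriv (hf : LocallyAC₂ f U) (hst : uIcc s t ⊆ U) :
    AbsolutelyContinuousOnInterval (deriv f) s t := by
  rcases le_total s t with h | h
  · exact hf.ac_deriv s t h (uIcc_of_le h ▸ hst)
  · exact (hf.ac_deriv t s h (uIcc_of_ge h ▸ hst)).symm

theorem star (hf : LocallyAC₂ f U) : LocallyAC₂ (star f) U := by
  have hderiv : deriv (Star.star f) = Star.star (deriv f) := deriv.star'
  refine ⟨fun y hy => (hf.differentiableAt y hy).star, fun c d hcd h =>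
    absolutelyContinuousOnInterval_star (hf.ac c d hcd h), fun c d hcd h => ?_⟩
  rw [hderiv]
  exact absolutelyContinuousOnInterval_star (hf.ac_deriv c d hcd h)

theorem continuousAt_cauchyData (hf : LocallyAC₂ f U) (hU : IsOpen U) {y : ℝ} (hy : y ∈ U) :
    ContinuousAt (cauchyData f) y := by
  obtain ⟨ε, hε, hsub⟩ := Metric.nhds_basis_closedBall.mem_iff.1 (hU.mem_nhds hy)
  rw [Real.closedBall_eq_Icc, ← uIcc_of_le (by linarith)] at hsub
  refine tendsto_cauchyData_iff.2 ⟨(hf.differentiableAt y hy).continuousAt,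
    (hf.absolutelyContinuousOnInterval_deriv hsub).continuousOn.continuousAt ?_⟩
  rw [uIcc_of_le (by linarith)]
  exact Icc_mem_nhds (by linarith) (by linarith)

theorem wronskian_eq_of_uIcc_subset (hf : LocallyAC₂ f U) (hg : LocallyAC₂ g U) (hU : IsOpen U)
    (hfQ : ∀ᵐ y, y ∈ U → deriv (deriv f) y = Q y * f y)
    (hgQ : ∀ᵐ y, y ∈ U → deriv (deriv g) y = Q y * g y) (hst : uIcc s t ⊆ U) :
    wronskian f g s = wronskian f g t := by
  have hW : AbsolutelyContinuousOnInterval (wronskian f g) s t :=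
    ((hf.absolutelyContinuousOnInterval hst).smul
      (hg.absolutelyContinuousOnInterval_deriv hst)).sub
      ((hf.absolutelyContinuousOnInterval_deriv hst).smul (hg.absolutelyContinuousOnInterval hst))
  have hW' : ∀ᵐ y, y ∈ uIcc s t → HasDerivAt (wronskian f g) 0 y := by
    filter_upwards [hfQ, hgQ, hf.ae_differentiableAt hU, hg.ae_differentiableAt hU]
      with y hfy hgy hfy' hgy' hy
    have hyU := hst hy
    refine (((hf.differentiableAt y hyU).hasDerivAt.mul (hgy' hyU).hasDerivAt).sub
      ((hfy' hyU).hasDerivAt.mul (hg.differentiableAt y hyU).hasDerivAt)).congr_deriv ?_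
    rw [hfy hyU, hgy hyU]
    ring
  obtain ⟨C, hC⟩ := hW.const_of_ae_hasDerivAt_zero hW'
  rw [hC s left_mem_uIcc, hC t right_mem_uIcc]

theorem ae_abs_deriv_energy_le (hf : LocallyAC₂ f U) (hU : IsOpen U)
    (hfQ : ∀ᵐ y, y ∈ U → deriv (deriv f) y = Q y * f y) :
    ∀ᵐ y, y ∈ U → |deriv (energy f) y| ≤ (1 + ‖Q y‖) * energy f y := by
  filter_upwards [hfQ, hf.ae_differentiableAt hU] with y hy hy' hyU
  have hderiv : HasDerivAt (energy f)
      (2 * inner ℝ (f y) (deriv f y) + 2 * inner ℝ (deriv f y) (Q y * f y)) y := by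
    rw [← hy hyU]
    exact (hf.differentiableAt y hyU).hasDerivAt.norm_sq.add (hy' hyU).hasDerivAt.norm_sq
  have hinner : |inner ℝ (f y) (deriv f y)| ≤ ‖f y‖ * ‖deriv f y‖ := abs_real_inner_le_norm _ _
  have hinner' : |inner ℝ (deriv f y) (Q y * f y)| ≤ ‖deriv f y‖ * (‖Q y‖ * ‖f y‖) :=
    norm_mul (Q y) (f y) ▸ abs_real_inner_le_norm _ _
  rw [hderiv.deriv]
  calc _ ≤ 2 * |inner ℝ (f y) (deriv f y)| + 2 * |inner ℝ (deriv f y) (Q y * f y)| := by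
        refine (abs_add_le _ _).trans_eq ?_
        rw [abs_mul, abs_mul, abs_two]
    _ ≤ (1 + ‖Q y‖) * (2 * ‖f y‖ * ‖deriv f y‖) := by linarith
    _ ≤ (1 + ‖Q y‖) * energy f y :=
        mul_le_mul_of_nonneg_left (two_mul_le_add_sq _ _) (by positivity)

theorem absolutelyContinuousOnInterval_energy (hf : LocallyAC₂ f U) (hst : uIcc s t ⊆ U) :
    AbsolutelyContinuousOnInterval (energy f) s t := by
  have hf₀ := absolutelyContinuousOnInterval_norm (hf.absolutelyContinuousOnInterval hst)
  have hf₁ := absolutelyContinuousOnInterval_norm (hf.absolutelyContinuousOnInterval_deriv hst)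
  have henergy : energy f = (fun y => ‖f y‖ * ‖f y‖) + fun y => ‖deriv f y‖ * ‖deriv f y‖ :=
    funext fun y => by simp only [energy, sq, Pi.add_apply]
  rw [henergy]
  exact (hf₀.fun_mul hf₀).add (hf₁.fun_mul hf₁)

theorem energy_le_exp_mul (hf : LocallyAC₂ f U) (hU : IsOpen U)
    (hfQ : ∀ᵐ y, y ∈ U → deriv (deriv f) y = Q y * f y)
    (hQ : IntegrableOn (fun y => 1 + ‖Q y‖) T) (hst : uIcc s t ⊆ U ∩ T) :
    energy f t ≤ Real.exp (∫ y in T, (1 + ‖Q y‖)) * energy f s := by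
  have hk : IntervalIntegrable (fun y => 1 + ‖Q y‖) volume s t :=
    (hQ.mono_set (hst.trans inter_subset_right)).intervalIntegrable
  refine (le_exp_integral_mul_of_ae_abs_deriv_le
    (hf.absolutelyContinuousOnInterval_energy (hst.trans inter_subset_left)) hk
    ((hf.ae_abs_deriv_energy_le hU hfQ).mono fun y hy hyst => hy (hst hyst).1)).trans
    (mul_le_mul_of_nonneg_right (Real.exp_le_exp.2 ?_) (energy_nonneg f s))
  exact setIntegral_mono_set hQ (ae_of_all _ fun y => by positivity)
    (uIoc_subset_uIcc.trans (hst.trans inter_subset_right)).eventuallyLE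

end LocallyAC₂

theorem eventually_eventually_uIcc_subset {F : Filter ℝ} [TendstoIxxClass Icc F F] {U : Set ℝ}
    (hU : U ∈ F) : ∀ᶠ s in F, ∀ᶠ t in F, uIcc s t ⊆ U :=
  ((tendsto_fst.uIcc tendsto_snd).eventually (eventually_smallSets_subset.2 hU)).curry

namespace LocallyAC₂

variable {f g : ℝ → ℂ} {Q : ℝ → ℂ} {U T : Set ℝ} {F : Filter ℝ} [F.NeBot]
  [TendstoIxxClass Icc F F] {u v : Fin 2 → ℂ}

theorem eventually_wronskian_eq (hf : LocallyAC₂ f U) (hg : LocallyAC₂ g U) (hU : IsOpen U)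
    (hfQ : ∀ᵐ y, y ∈ U → deriv (deriv f) y = Q y * f y)
    (hgQ : ∀ᵐ y, y ∈ U → deriv (deriv g) y = Q y * g y) (hUF : U ∈ F)
    (hu : Tendsto (cauchyData f) F (𝓝 u)) (hv : Tendsto (cauchyData g) F (𝓝 v)) :
    ∀ᶠ y in F, wronskian f g y = symplecticForm u v := by
  filter_upwards [eventually_eventually_uIcc_subset hUF] with s hs
  exact tendsto_nhds_unique_of_eventuallyEq tendsto_const_nhds (tendsto_wronskian hu hv)
    (hs.mono fun t hst => hf.wronskian_eq_of_uIcc_subset hg hU hfQ hgQ hst)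

theorem eventually_cauchyData_eq_zero_iff (hf : LocallyAC₂ f U) (hU : IsOpen U)
    (hfQ : ∀ᵐ y, y ∈ U → deriv (deriv f) y = Q y * f y)
    (hQ : IntegrableOn (fun y => 1 + ‖Q y‖) T) (hUF : U ∈ F) (hTF : T ∈ F)
    (hu : Tendsto (cauchyData f) F (𝓝 u)) :
    ∀ᶠ y in F, (cauchyData f y = 0 ↔ u = 0) := by
  rcases eq_or_ne u 0 with rfl | hu0
  · filter_upwards [eventually_eventually_uIcc_subset (inter_mem hUF hTF)] with s hs
    have hle : energy f s ≤ Real.exp (∫ y in T, (1 + ‖Q y‖)) * 0 :=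
      ge_of_tendsto ((tendsto_energy_zero hu).const_mul _)
        (hs.mono fun t hst => hf.energy_le_exp_mul hU hfQ hQ (uIcc_comm s t ▸ hst))
    rw [mul_zero] at hle
    exact iff_of_true (energy_eq_zero_iff.1 (hle.antisymm (energy_nonneg f s))) rfl
  · filter_upwards [hu.eventually_ne hu0] with s hs using iff_of_false hs hu0

end LocallyAC₂

/-! ### Solutions across the interaction points -/

theorem eq_of_eventually_eq_off {α : Type*} {W : ℝ → α} {K M : Set ℝ} (hK : IsPreconnected K)
    (hM : ∀ p ∈ K, Mᶜ ∈ 𝓝[≠] p) (hoff : ∀ p ∈ K \ M, ∀ᶠ y in 𝓝 p, W y = W p)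
    (hon : ∀ p ∈ K ∩ M, ∃ k, ∀ᶠ y in 𝓝[≠] p, W y = k) {c d : ℝ} (hc : c ∈ K \ M)
    (hd : d ∈ K \ M) : W c = W d := by
  -- `k` extends `W` continuously, for the discrete topology, across the exceptional points.
  have hext : ∀ p ∈ K, ∃ k, (p ∉ M → k = W p) ∧ ∀ᶠ y in 𝓝[≠] p, W y = k := fun p hp => by
    by_cases hpM : p ∈ M
    · exact (hon p ⟨hp, hpM⟩).imp fun k hk => ⟨fun h => absurd hpM h, hk⟩
    · exact ⟨W p, fun _ => rfl, (hoff p ⟨hp, hpM⟩).filter_mono nhdsWithin_le_nhds⟩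
  have : Nonempty α := ⟨W 0⟩
  choose! k hkW hk using hext
  have hloc : ∀ p ∈ K, ∀ᶠ y in 𝓝[K] p, k y = k p := by
    intro p hp
    filter_upwards [mem_nhdsWithin_of_mem_nhds
      (eventually_nhdsWithin_iff.1 ((hk p hp).and (hM p hp))), self_mem_nhdsWithin] with y hy hyK
    by_cases hyp : y = p
    · rw [hyp]
    · rw [hkW y hyK (hy hyp).2, (hy hyp).1]
  rw [← hkW c hc.1 hc.2, ← hkW d hd.1 hd.2]
  let _ : TopologicalSpace α := ⊥
  have : DiscreteTopology α := ⟨rfl⟩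
  exact hK.constant (f := k) (fun p hp => tendsto_nhds_of_eventually_eq (hloc p hp)) hc.1 hd.1

namespace SturmData

/-- `f` solves `(τ - z) f = 0` in the set `K`, with the matrix `A n` at each `x n ∈ K`. Restricting
`IsSolution` to subintervals is what allows two families of matrices to be compared away from the
points at which they differ. -/
structure IsSolutionOn (S : SturmData) (A : S.idx → Matrix (Fin 2) (Fin 2) ℝ) (z : ℂ) (K : Set ℝ)
    (f : ℝ → ℂ) : Prop where
  ac : LocallyAC₂ f (K \ S.M)
  eqn : ∀ᵐ y, y ∈ K → sturmExpr S.V f y = z * f y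
  jump : ∀ n, S.x n ∈ K → JumpCondition (A n) f (S.x n)

variable {S : SturmData}

theorem ordConnected_J (S : SturmData) : S.J.OrdConnected :=
  ⟨fun _ hx _ hy _ hw => ⟨hx.1.trans_le (by exact_mod_cast hw.1),
    lt_of_le_of_lt (by exact_mod_cast hw.2) hy.2⟩⟩

theorem sdiff_M_mem_punctured {K : Set ℝ} (hK : IsOpen K) (hKJ : K ⊆ S.J) {p : ℝ} (hp : p ∈ K) :
    K \ S.M ∈ 𝓝[≠] p :=
  mem_of_superset (inter_mem (mem_nhdsWithin_of_mem_nhds (hK.mem_nhds hp))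
    (S.diff_mem_punctured (hKJ hp))) fun _ hy => ⟨hy.1, hy.2.2⟩

theorem isOpen_sdiff_M {K : Set ℝ} (hK : IsOpen K) (hKJ : K ⊆ S.J) : IsOpen (K \ S.M) := by
  rw [← inter_eq_left.2 hKJ, inter_sdiff_assoc]
  exact hK.inter S.isOpen_diff

theorem exists_mem_nhds_integrableOn {p : ℝ} (hp : p ∈ S.J) (z : ℂ) :
    ∃ T ∈ 𝓝 p, IntegrableOn (fun y => 1 + ‖(S.V y : ℂ) - z‖) T := by
  obtain ⟨T, hT, hV⟩ := S.locallyIntegrable p hp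
  replace hT : T ∈ 𝓝 p := S.isOpen_J.nhdsWithin_eq hp ▸ hT
  refine ⟨T ∩ Metric.ball p 1, inter_mem hT (Metric.ball_mem_nhds p one_pos), ?_⟩
  have hfin : volume (T ∩ Metric.ball p 1) ≠ ⊤ :=
    ((measure_mono inter_subset_right).trans_lt measure_ball_lt_top).ne
  have hV' : IntegrableOn (fun y => (S.V y : ℂ)) (T ∩ Metric.ball p 1) :=
    (hV.mono_set inter_subset_left).ofReal
  exact (integrableOn_const hfin).add (hV'.sub (integrableOn_const hfin)).norm

/-- The family of matrices `A_{α_n, r_n, θ_n}`. -/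
noncomputable abbrev interactionMatrices {ι : Type*} (Λ R Θ : ι → ℝ) (n : ι) :
    Matrix (Fin 2) (Fin 2) ℝ :=
  interactionMatrix (Λ n) (R n) (Θ n)

theorem IsSolution.isSolutionOn {Λ R Θ : S.idx → ℝ} {z : ℂ} {f : ℝ → ℂ}
    (hf : S.IsSolution Λ R Θ z 0 f) : S.IsSolutionOn (interactionMatrices Λ R Θ) z S.J f :=
  ⟨hf.ac, ((ae_restrict_iff' S.isOpen_J.measurableSet).1 hf.eqn).mono
    fun _ hy hyJ => sub_eq_zero.1 (hy hyJ), fun n _ => hf.jump n⟩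

namespace IsSolutionOn

variable {A : S.idx → Matrix (Fin 2) (Fin 2) ℝ} {z : ℂ} {K : Set ℝ} {f g u : ℝ → ℂ}

theorem mono {A' : S.idx → Matrix (Fin 2) (Fin 2) ℝ} {K' : Set ℝ} (hf : S.IsSolutionOn A z K f)
    (hK : K' ⊆ K) (hA : ∀ n, S.x n ∈ K' → A n = A' n) : S.IsSolutionOn A' z K' f :=
  ⟨hf.ac.mono (sdiff_subset_sdiff_left hK), hf.eqn.mono fun _ hy hyK => hy (hK hyK),
    fun n hn => hA n hn ▸ hf.jump n (hK hn)⟩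

theorem star {E : ℝ} (hf : S.IsSolutionOn A E K f) : S.IsSolutionOn A E K (star f) := by
  have hderiv : ∀ f : ℝ → ℂ, deriv (Star.star f) = Star.star (deriv f) := fun _ => deriv.star'
  refine ⟨hf.ac.star, hf.eqn.mono fun y hy hyK => ?_, fun n hn => (hf.jump n hn).star⟩
  have hstar := congrArg Star.star (hy hyK)
  simp only [sturmExpr, star_add, star_neg, star_mul', Complex.star_def, Complex.conj_ofReal]
    at hstar
  simp only [sturmExpr, hderiv, Pi.star_apply, Complex.star_def]
  exact hstar

theorem deriv_deriv_eq (hf : S.IsSolutionOn A z K f) :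
    ∀ᵐ y, y ∈ K \ S.M → deriv (deriv f) y = ((S.V y : ℂ) - z) * f y := by
  filter_upwards [hf.eqn] with y hy hyK
  have heq := hy hyK.1
  rw [sturmExpr] at heq
  linear_combination -heq

variable (hA : ∀ n, (A n).det = 1) (hK : IsOpen K) (hKJ : K ⊆ S.J) (hKc : IsPreconnected K)
include hA hK hKJ hKc

theorem wronskian_eq (hf : S.IsSolutionOn A z K f) (hg : S.IsSolutionOn A z K g) {c d : ℝ}
    (hc : c ∈ K \ S.M) (hd : d ∈ K \ S.M) : wronskian f g c = wronskian f g d := by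
  have hU := isOpen_sdiff_M hK hKJ
  refine eq_of_eventually_eq_off hKc
    (fun p hp => mem_of_superset (sdiff_M_mem_punctured hK hKJ hp) fun _ hy => hy.2)
    (fun p hp => ?_) ?_ hc hd
  · exact hf.ac.eventually_wronskian_eq hg.ac hU hf.deriv_deriv_eq hg.deriv_deriv_eq
      (hU.mem_nhds hp) (hf.ac.continuousAt_cauchyData hU hp) (hg.ac.continuousAt_cauchyData hU hp)
  · rintro _ ⟨hp, n, rfl⟩
    obtain ⟨l, hfl, hfr⟩ := jumpCondition_iff.1 (hf.jump n hp)
    obtain ⟨m, hgl, hgr⟩ := jumpCondition_iff.1 (hg.jump n hp)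
    have hKp := sdiff_M_mem_punctured hK hKJ hp
    rw [← nhdsLT_sup_nhdsGT] at hKp ⊢
    refine ⟨symplecticForm l m, eventually_sup.2 ⟨hf.ac.eventually_wronskian_eq hg.ac hU
      hf.deriv_deriv_eq hg.deriv_deriv_eq hKp.1 hfl hgl, ?_⟩⟩
    rw [← symplecticForm_complexify_mulVec (hA n) l m]
    exact hf.ac.eventually_wronskian_eq hg.ac hU hf.deriv_deriv_eq hg.deriv_deriv_eq hKp.2 hfr hgr

theorem cauchyData_eq_zero_iff (hf : S.IsSolutionOn A z K f) {c d : ℝ} (hc : c ∈ K \ S.M)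
    (hd : d ∈ K \ S.M) : cauchyData f c = 0 ↔ cauchyData f d = 0 := by
  have hU := isOpen_sdiff_M hK hKJ
  refine iff_of_eq (eq_of_eventually_eq_off (W := fun y => cauchyData f y = 0) hKc
    (fun p hp => mem_of_superset (sdiff_M_mem_punctured hK hKJ hp) fun _ hy => hy.2)
    (fun p hp => ?_) ?_ hc hd)
  · obtain ⟨T, hT, hQ⟩ := exists_mem_nhds_integrableOn (hKJ hp.1) z
    exact (hf.ac.eventually_cauchyData_eq_zero_iff hU hf.deriv_deriv_eq hQ (hU.mem_nhds hp) hT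
      (hf.ac.continuousAt_cauchyData hU hp)).mono fun _ => propext
  · rintro _ ⟨hp, n, rfl⟩
    obtain ⟨T, hT, hQ⟩ := exists_mem_nhds_integrableOn (hKJ hp) z
    obtain ⟨l, hl, hr⟩ := jumpCondition_iff.1 (hf.jump n hp)
    have hr0 : complexify (A n) *ᵥ l = 0 ↔ l = 0 := by
      refine ⟨Matrix.eq_zero_of_mulVec_eq_zero ?_, fun h => by rw [h, Matrix.mulVec_zero]⟩
      rw [det_complexify, hA n, Complex.ofReal_one]
      exact one_ne_zero
    have hKp := sdiff_M_mem_punctured hK hKJ hp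
    rw [← nhdsLT_sup_nhdsGT] at hKp ⊢
    refine ⟨l = 0, eventually_sup.2 ⟨?_, ?_⟩⟩
    · exact (hf.ac.eventually_cauchyData_eq_zero_iff hU hf.deriv_deriv_eq hQ hKp.1
        (mem_nhdsWithin_of_mem_nhds hT) hl).mono fun _ => propext
    · exact (hf.ac.eventually_cauchyData_eq_zero_iff hU hf.deriv_deriv_eq hQ hKp.2
        (mem_nhdsWithin_of_mem_nhds hT) hr).mono fun _ hy => propext (hy.trans hr0)

theorem cauchyData_eq_zero_of_tendsto (hf : S.IsSolutionOn A z K f) {p : ℝ} (hp : p ∈ K)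
    (h0 : Tendsto (cauchyData f) (𝓝[<] p) (𝓝 0)) {y : ℝ} (hy : y ∈ K \ S.M) :
    cauchyData f y = 0 := by
  obtain ⟨T, hT, hQ⟩ := exists_mem_nhds_integrableOn (hKJ hp) z
  have hKp : K \ S.M ∈ 𝓝[<] p := nhdsLT_le_nhdsNE p (sdiff_M_mem_punctured hK hKJ hp)
  obtain ⟨w, hw0, hw⟩ := ((hf.ac.eventually_cauchyData_eq_zero_iff (isOpen_sdiff_M hK hKJ)
    hf.deriv_deriv_eq hQ hKp (mem_nhdsWithin_of_mem_nhds hT) h0).and hKp).exists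
  exact (hf.cauchyData_eq_zero_iff hA hK hKJ hKc hw hy).1 (hw0.2 rfl)

/-- Here `u` is a linear combination of `f` and `g` as soon as their Wronskian does not vanish. -/
theorem wronskian_eq_zero_of_not_memLp (hf : S.IsSolutionOn A z K f)
    (hg : S.IsSolutionOn A z K g) (hu : S.IsSolutionOn A z K u) {p : ENNReal}
    (hfp : MemLp f p (volume.restrict K)) (hgp : MemLp g p (volume.restrict K))
    (hup : ¬ MemLp u p (volume.restrict K)) {y : ℝ} (hy : y ∈ K \ S.M) :
    wronskian f g y = 0 := by
  by_contra hne
  refine hup (((hfp.const_smul (wronskian u g y / wronskian f g y)).add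
    (hgp.const_smul (wronskian f u y / wronskian f g y))).ae_eq ?_)
  have hwM : ∀ᵐ w ∂volume.restrict K, w ∉ S.M :=
    ae_restrict_of_ae ((countable_range S.x).ae_notMem volume)
  filter_upwards [hwM, ae_restrict_mem hK.measurableSet] with w hwM hwK
  have hw : w ∈ K \ S.M := ⟨hwK, hwM⟩
  have hdecomp : wronskian f g w * u w = wronskian u g w * f w + wronskian f u w * g w :=
    congrFun (symplecticForm_smul_eq_add (cauchyData f w) (cauchyData g w) (cauchyData u w)) 0
  rw [hf.wronskian_eq hA hK hKJ hKc hg hw hy, hu.wronskian_eq hA hK hKJ hKc hg hw hy,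
    hf.wronskian_eq hA hK hKJ hKc hu hw hy] at hdecomp
  simp only [Pi.add_apply, Pi.smul_apply, smul_eq_mul]
  field_simp
  exact hdecomp.symm

theorem wronskian_eq_zero_of_boundaryCondition (hf : S.IsSolutionOn A z K f)
    (hg : S.IsSolutionOn A z K g) {F : Filter ℝ} [F.NeBot] (hF : K \ S.M ∈ F) {ψ : ℝ}
    (hfψ : BoundaryCondition ψ f F) (hgψ : BoundaryCondition ψ g F) {y : ℝ}
    (hy : y ∈ K \ S.M) : wronskian f g y = 0 := by
  refine tendsto_nhds_unique_of_eventuallyEq tendsto_const_nhds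
    (hfψ.tendsto_wronskian_zero hgψ) ?_
  filter_upwards [hF] with w hw using hf.wronskian_eq hA hK hKJ hKc hg hy hw

end IsSolutionOn

end SturmData

/-! ### Weyl solutions -/

namespace SturmData

variable {S : SturmData}

/-- Solutions to the left of `p` that are candidates for eigenfunctions: they are square integrable
and satisfy the boundary condition at `a` if there is one. -/
structure IsWeylLeft (S : SturmData) (ψ : ℝ) (A : S.idx → Matrix (Fin 2) (Fin 2) ℝ) (z : ℂ)
    (p : ℝ) (f : ℝ → ℂ) : Prop where
  isSolutionOn : S.IsSolutionOn A z (S.J ∩ Iio p) f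
  memLp : MemLp f 2 (volume.restrict (S.J ∩ Iio p))
  boundaryCondition : ∀ a₀, S.RegularLeftAt a₀ → BoundaryCondition ψ f (𝓝[>] a₀)

/-- The counterpart of `IsWeylLeft` to the right of `p`. -/
structure IsWeylRight (S : SturmData) (ψ : ℝ) (A : S.idx → Matrix (Fin 2) (Fin 2) ℝ) (z : ℂ)
    (p : ℝ) (f : ℝ → ℂ) : Prop where
  isSolutionOn : S.IsSolutionOn A z (S.J ∩ Ioi p) f
  memLp : MemLp f 2 (volume.restrict (S.J ∩ Ioi p))
  boundaryCondition : ∀ b₀, S.RegularRightAt b₀ → BoundaryCondition ψ f (𝓝[<] b₀)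

section Domain

variable {ψa ψb : ℝ} {Λ R Θ : S.idx → ℝ} {A A' : S.idx → Matrix (Fin 2) (Fin 2) ℝ} {z : ℂ} {p : ℝ}
  {f : ℝ → ℂ}

theorem InDomain.isWeylLeft (hf : S.InDomain ψa ψb Λ R Θ f) (hfz : S.IsSolutionOn A z S.J f)
    (hA : ∀ n, S.x n < p → A n = A' n) : S.IsWeylLeft ψa A' z p f :=
  ⟨hfz.mono inter_subset_left fun n hn => hA n hn.2,
    hf.max.memLp.mono_measure (Measure.restrict_mono_set _ inter_subset_left), hf.left⟩

theorem InDomain.isWeylRight (hf : S.InDomain ψa ψb Λ R Θ f) (hfz : S.IsSolutionOn A z S.J f)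
    (hA : ∀ n, p < S.x n → A n = A' n) : S.IsWeylRight ψb A' z p f :=
  ⟨hfz.mono inter_subset_left fun n hn => hA n hn.2,
    hf.max.memLp.mono_measure (Measure.restrict_mono_set _ inter_subset_left), hf.right⟩

end Domain

section Star

variable {ψ : ℝ} {A : S.idx → Matrix (Fin 2) (Fin 2) ℝ} {E : ℝ} {p : ℝ} {f : ℝ → ℂ}

theorem IsWeylLeft.star (hf : S.IsWeylLeft ψ A E p f) : S.IsWeylLeft ψ A E p (star f) :=
  ⟨hf.isSolutionOn.star, hf.memLp.star, fun a₀ ha => (hf.boundaryCondition a₀ ha).star⟩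

theorem IsWeylRight.star (hf : S.IsWeylRight ψ A E p f) : S.IsWeylRight ψ A E p (star f) :=
  ⟨hf.isSolutionOn.star, hf.memLp.star, fun b₀ hb => (hf.boundaryCondition b₀ hb).star⟩

end Star

variable {ψ : ℝ} {Λ R Θ : S.idx → ℝ} {z : ℂ} {p : ℝ} {f g : ℝ → ℂ} {l m : Fin 2 → ℂ}

theorem IsWeylLeft.wronskian_eq_zero (hR : ∀ n, R n ≠ 0)
    (hleft : S.LimitPointLeft Λ R Θ ∨ S.RegularLeft) (hp : p ∈ S.J)
    (hf : S.IsWeylLeft ψ (interactionMatrices Λ R Θ) z p f)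
    (hg : S.IsWeylLeft ψ (interactionMatrices Λ R Θ) z p g) {y : ℝ}
    (hy : y ∈ (S.J ∩ Iio p) \ S.M) : wronskian f g y = 0 := by
  have hA : ∀ n, (interactionMatrices Λ R Θ n).det = 1 := fun n =>
    det_interactionMatrix _ _ (hR n)
  have hK : IsOpen (S.J ∩ Iio p) := S.isOpen_J.inter isOpen_Iio
  have hKc : IsPreconnected (S.J ∩ Iio p) :=
    (S.ordConnected_J.inter ordConnected_Iio).isPreconnected
  rcases hleft with hlp | ⟨a₀, ha⟩
  · obtain ⟨u, hu, hu2⟩ := hlp z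
    exact hf.isSolutionOn.wronskian_eq_zero_of_not_memLp hA hK inter_subset_left hKc
      hg.isSolutionOn (hu.isSolutionOn.mono inter_subset_left fun _ _ => rfl) hf.memLp hg.memLp
      (fun hmem => hu2 ⟨p, hp, hmem⟩) hy
  · have hap : a₀ < p := by
      have := hp.1
      rw [ha.eq] at this
      exact_mod_cast this
    have hmem : (S.J ∩ Iio p) \ S.M ∈ 𝓝[>] a₀ := by
      rw [inter_sdiff_right_comm]
      exact inter_mem ha.mem (mem_nhdsWithin_of_mem_nhds (Iio_mem_nhds hap))
    exact hf.isSolutionOn.wronskian_eq_zero_of_boundaryCondition hA hK inter_subset_left hKc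
      hg.isSolutionOn hmem (hf.boundaryCondition a₀ ha) (hg.boundaryCondition a₀ ha) hy

theorem IsWeylRight.wronskian_eq_zero (hR : ∀ n, R n ≠ 0)
    (hright : S.LimitPointRight Λ R Θ ∨ S.RegularRight) (hp : p ∈ S.J)
    (hf : S.IsWeylRight ψ (interactionMatrices Λ R Θ) z p f)
    (hg : S.IsWeylRight ψ (interactionMatrices Λ R Θ) z p g) {y : ℝ}
    (hy : y ∈ (S.J ∩ Ioi p) \ S.M) : wronskian f g y = 0 := by
  have hA : ∀ n, (interactionMatrices Λ R Θ n).det = 1 := fun n =>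
    det_interactionMatrix _ _ (hR n)
  have hK : IsOpen (S.J ∩ Ioi p) := S.isOpen_J.inter isOpen_Ioi
  have hKc : IsPreconnected (S.J ∩ Ioi p) :=
    (S.ordConnected_J.inter ordConnected_Ioi).isPreconnected
  rcases hright with hlp | ⟨b₀, hb⟩
  · obtain ⟨u, hu, hu2⟩ := hlp z
    exact hf.isSolutionOn.wronskian_eq_zero_of_not_memLp hA hK inter_subset_left hKc
      hg.isSolutionOn (hu.isSolutionOn.mono inter_subset_left fun _ _ => rfl) hf.memLp hg.memLp
      (fun hmem => hu2 ⟨p, hp, hmem⟩) hy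
  · have hpb : p < b₀ := by
      have := hp.2
      rw [hb.eq] at this
      exact_mod_cast this
    have hmem : (S.J ∩ Ioi p) \ S.M ∈ 𝓝[<] b₀ := by
      rw [inter_sdiff_right_comm]
      exact inter_mem hb.mem (mem_nhdsWithin_of_mem_nhds (Ioi_mem_nhds hpb))
    exact hf.isSolutionOn.wronskian_eq_zero_of_boundaryCondition hA hK inter_subset_left hKc
      hg.isSolutionOn hmem (hf.boundaryCondition b₀ hb) (hg.boundaryCondition b₀ hb) hy

theorem IsWeylLeft.symplecticForm_eq_zero (hR : ∀ n, R n ≠ 0)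
    (hleft : S.LimitPointLeft Λ R Θ ∨ S.RegularLeft) (hp : p ∈ S.J)
    (hf : S.IsWeylLeft ψ (interactionMatrices Λ R Θ) z p f)
    (hg : S.IsWeylLeft ψ (interactionMatrices Λ R Θ) z p g)
    (hl : Tendsto (cauchyData f) (𝓝[<] p) (𝓝 l))
    (hm : Tendsto (cauchyData g) (𝓝[<] p) (𝓝 m)) : symplecticForm l m = 0 := by
  refine tendsto_nhds_unique_of_eventuallyEq (tendsto_wronskian hl hm) tendsto_const_nhds ?_
  filter_upwards [nhdsLT_le_nhdsNE p (S.diff_mem_punctured hp), self_mem_nhdsWithin] with y hy hyp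
  exact hf.wronskian_eq_zero hR hleft hp hg ⟨⟨hy.1, hyp⟩, hy.2⟩

theorem IsWeylRight.symplecticForm_eq_zero (hR : ∀ n, R n ≠ 0)
    (hright : S.LimitPointRight Λ R Θ ∨ S.RegularRight) (hp : p ∈ S.J)
    (hf : S.IsWeylRight ψ (interactionMatrices Λ R Θ) z p f)
    (hg : S.IsWeylRight ψ (interactionMatrices Λ R Θ) z p g)
    (hl : Tendsto (cauchyData f) (𝓝[>] p) (𝓝 l))
    (hm : Tendsto (cauchyData g) (𝓝[>] p) (𝓝 m)) : symplecticForm l m = 0 := by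
  refine tendsto_nhds_unique_of_eventuallyEq (tendsto_wronskian hl hm) tendsto_const_nhds ?_
  filter_upwards [nhdsGT_le_nhdsNE p (S.diff_mem_punctured hp), self_mem_nhdsWithin] with y hy hyp
  exact hf.wronskian_eq_zero hR hright hp hg ⟨⟨hy.1, hyp⟩, hy.2⟩

/-! ### Eigenvalues under a change of one angle -/

variable {ψa ψb : ℝ}

theorem exists_isSolutionOn_of_mem_pointSpectrum
    (hz : z ∈ pointSpectrum (S.hamiltonian ψa ψb Λ R Θ)) :
    ∃ f, S.InDomain ψa ψb Λ R Θ f ∧ S.IsSolutionOn (interactionMatrices Λ R Θ) z S.J f ∧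
      ∃ y ∈ S.J \ S.M, f y ≠ 0 := by
  obtain ⟨φ, hφ, hφz⟩ := hz
  have hd := S.rep_inDomain ψa ψb Λ R Θ φ
  have hrep := S.coe_ae_eq_rep ψa ψb Λ R Θ φ
  have heq := S.hamiltonian_ae_eq ψa ψb Λ R Θ φ hd hrep
  rw [hφz] at heq
  refine ⟨_, hd, IsSolution.isSolutionOn ⟨hd.max.ac, ?_, hd.max.jump⟩, ?_⟩
  · filter_upwards [heq, hrep, Lp.coeFn_smul z (φ : S.L2)] with y hy hyrep hysmul
    rw [← hy, hysmul, Pi.smul_apply, hyrep, smul_eq_mul, sub_self, Pi.zero_apply]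
  · by_contra! hzero
    refine hφ (Subtype.ext (Lp.ext (hrep.trans ?_)))
    filter_upwards [S.ae_mem_diff, Lp.coeFn_zero ℂ 2 S.μ] with y hy hy0
    exact (hzero y hy).trans hy0.symm

theorem exists_tendsto_of_mem_pointSpectrum (hR : ∀ n, R n ≠ 0)
    (hz : z ∈ pointSpectrum (S.hamiltonian ψa ψb Λ R Θ)) (n : S.idx) :
    ∃ f l, S.InDomain ψa ψb Λ R Θ f ∧ S.IsSolutionOn (interactionMatrices Λ R Θ) z S.J f ∧
      l ≠ 0 ∧ Tendsto (cauchyData f) (𝓝[<] S.x n) (𝓝 l) ∧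
      Tendsto (cauchyData f) (𝓝[>] S.x n) (𝓝 (complexify (interactionMatrices Λ R Θ n) *ᵥ l)) := by
  obtain ⟨f, hfd, hf, y, hy, hfy⟩ := exists_isSolutionOn_of_mem_pointSpectrum hz
  obtain ⟨l, hl, hr⟩ := jumpCondition_iff.1 (hf.jump n (S.x_mem n))
  refine ⟨f, l, hfd, hf, ?_, hl, hr⟩
  rintro rfl
  exact hfy (congrFun (hf.cauchyData_eq_zero_of_tendsto
    (fun n => det_interactionMatrix _ _ (hR n)) S.isOpen_J subset_rfl
    S.ordConnected_J.isPreconnected (S.x_mem n) hl hy) 0)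

theorem sin_sub_eq_zero_of_mem_pointSpectrum {Θ' : S.idx → ℝ} (hR : ∀ n, R n ≠ 0)
    (hleft : S.LimitPointLeft Λ R Θ ∨ S.RegularLeft)
    (hright : S.LimitPointRight Λ R Θ ∨ S.RegularRight) {E : ℝ} {n₀ : S.idx}
    (hΘ : ∀ n, n ≠ n₀ → Θ' n = Θ n)
    (h : (E : ℂ) ∈ pointSpectrum (S.hamiltonian ψa ψb Λ R Θ))
    (h' : (E : ℂ) ∈ pointSpectrum (S.hamiltonian ψa ψb Λ R Θ')) :
    Real.sin (Θ' n₀ - Θ n₀) = 0 := by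
  obtain ⟨f, l, hfd, hf, hl, hfl, hfr⟩ := exists_tendsto_of_mem_pointSpectrum hR h n₀
  obtain ⟨g, m, hgd, hg, hm, hgl, hgr⟩ := exists_tendsto_of_mem_pointSpectrum hR h' n₀
  have hp : S.x n₀ ∈ S.J := S.x_mem n₀
  have hA : ∀ n, S.x n ≠ S.x n₀ → interactionMatrices Λ R Θ' n = interactionMatrices Λ R Θ n :=
    fun n hn => by rw [interactionMatrices, hΘ n fun e => hn (e ▸ rfl)]
  have hfL : S.IsWeylLeft ψa (interactionMatrices Λ R Θ) E (S.x n₀) f :=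
    hfd.isWeylLeft hf fun _ _ => rfl
  have hfR : S.IsWeylRight ψb (interactionMatrices Λ R Θ) E (S.x n₀) f :=
    hfd.isWeylRight hf fun _ _ => rfl
  have hgL : S.IsWeylLeft ψa (interactionMatrices Λ R Θ) E (S.x n₀) g :=
    hgd.isWeylLeft hg fun n hn => hA n hn.ne
  have hgR : S.IsWeylRight ψb (interactionMatrices Λ R Θ) E (S.x n₀) g :=
    hgd.isWeylRight hg fun n hn => hA n hn.ne'
  refine sin_sub_eq_zero_of_symplecticForm_eq_zero (α := Λ n₀) (hR n₀) hl hm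
    (hfL.symplecticForm_eq_zero hR hleft hp hgL hfl hgl)
    (hfL.symplecticForm_eq_zero hR hleft hp hgL.star hfl (tendsto_cauchyData_star hgl)) ?_
  rw [← star_complexify_mulVec]
  exact hfR.symplecticForm_eq_zero hR hright hp hgR.star hfr (tendsto_cauchyData_star hgr)

theorem countable_setOf_update_mem_pointSpectrum [DecidableEq S.idx] (hR : ∀ n, R n ≠ 0)
    (hleft : ∀ Θ : S.idx → ℝ, S.LimitPointLeft Λ R Θ ∨ S.RegularLeft)
    (hright : ∀ Θ : S.idx → ℝ, S.LimitPointRight Λ R Θ ∨ S.RegularRight) (E : ℝ) (n₀ : S.idx)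
    (Θ : S.idx → ℝ) :
    {t | (E : ℂ) ∈ pointSpectrum
      (S.hamiltonian ψa ψb Λ R (Function.update Θ n₀ t))}.Countable := by
  rcases eq_empty_or_nonempty {t | (E : ℂ) ∈ pointSpectrum
    (S.hamiltonian ψa ψb Λ R (Function.update Θ n₀ t))} with hempty | ⟨s, hs⟩
  · rw [hempty]
    exact countable_empty
  · refine (countable_range fun k : ℤ => k * Real.pi + s).mono fun t ht => ?_
    have hsin := sin_sub_eq_zero_of_mem_pointSpectrum hR (hleft _) (hright _) (n₀ := n₀)
      (fun n hn => by rw [Function.update_of_ne hn, Function.update_of_ne hn]) hs ht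
    rw [Function.update_self, Function.update_self] at hsin
    obtain ⟨k, hk⟩ := Real.sin_eq_zero_iff.1 hsin
    exact ⟨k, eq_sub_iff_add_eq.1 hk⟩

end SturmData

/-! ### Null sets of an infinite product measure -/

section InfinitePi

variable {ι : Type*} [DecidableEq ι] {X : ι → Type*} (i₀ : ι)

theorem preimage_update_pi_of_mem {s : Finset ι} (hs : i₀ ∈ s) (t : ∀ i, Set (X i)) :
    (fun p : (∀ i, X i) × X i₀ => Function.update p.1 i₀ p.2) ⁻¹' (Set.pi s t) =
      Set.pi (s.erase i₀) t ×ˢ t i₀ := by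
  ext p
  simp only [mem_preimage, Set.mem_pi, mem_prod, Finset.mem_coe, Finset.mem_erase]
  refine ⟨fun h => ⟨fun i hi => ?_, ?_⟩, fun h i hi => ?_⟩
  · simpa only [Function.update_of_ne hi.1] using h i hi.2
  · simpa only [Function.update_self] using h i₀ hs
  · rcases eq_or_ne i i₀ with rfl | hne
    · simpa only [Function.update_self] using h.2
    · simpa only [Function.update_of_ne hne] using h.1 i ⟨hne, hi⟩

theorem preimage_update_pi_of_notMem {s : Finset ι} (hs : i₀ ∉ s) (t : ∀ i, Set (X i)) :
    (fun p : (∀ i, X i) × X i₀ => Function.update p.1 i₀ p.2) ⁻¹' (Set.pi s t) =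
      Set.pi s t ×ˢ univ := by
  ext p
  simp only [mem_preimage, Set.mem_pi, mem_prod, Finset.mem_coe, mem_univ, and_true]
  exact forall₂_congr fun i hi => by rw [Function.update_of_ne (ne_of_mem_of_not_mem hi hs)]

variable [∀ i, MeasurableSpace (X i)] (q : ∀ i, Measure (X i)) [∀ i, IsProbabilityMeasure (q i)]

theorem map_update_infinitePi :
    ((Measure.infinitePi q).prod (q i₀)).map (fun p => Function.update p.1 i₀ p.2) =
      Measure.infinitePi q := by
  refine Measure.eq_infinitePi q fun s t ht => ?_
  rw [Measure.map_apply measurable_update' (.pi s.countable_toSet fun i _ => ht i)]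
  by_cases hs : i₀ ∈ s
  · rw [preimage_update_pi_of_mem i₀ hs, Measure.prod_prod,
      Measure.infinitePi_pi q fun i _ => ht i, Finset.prod_erase_mul _ _ hs]
  · rw [preimage_update_pi_of_notMem i₀ hs, Measure.prod_prod,
      Measure.infinitePi_pi q fun i _ => ht i, measure_univ, mul_one]

theorem infinitePi_eq_zero_of_forall_update {B : Set (∀ i, X i)}
    (hB : NullMeasurableSet B (Measure.infinitePi q))
    (hnull : ∀ ω, q i₀ {t | Function.update ω i₀ t ∈ B} = 0) : Measure.infinitePi q B = 0 := by
  obtain ⟨C, hCB, hC, hCeq⟩ := hB.exists_measurable_subset_ae_eq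
  rw [← measure_congr hCeq, ← map_update_infinitePi i₀ q,
    Measure.map_apply measurable_update' hC, Measure.measure_prod_null (measurable_update' hC)]
  exact ae_of_all _ fun ω => measure_mono_null (fun t ht => hCB ht) (hnull ω)

end InfinitePi

theorem mainTheorem4 (S : SturmData) (ψa ψb : ℝ) (Λ R : S.idx → ℝ) (hR : ∀ n, 0 < R n)
    (hleft : ∀ Θ : S.idx → ℝ, S.LimitPointLeft Λ R Θ ∨ S.RegularLeft)
    (hright : ∀ Θ : S.idx → ℝ, S.LimitPointRight Λ R Θ ∨ S.RegularRight)
    (q : S.idx → Measure ℝ) [∀ n, IsProbabilityMeasure (q n)]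
    (hq : ∃ n₀, ∀ t : ℝ, q n₀ {t} = 0) (E : ℝ)
    (B : Set (S.idx → ℝ)) (hB : NullMeasurableSet B (Measure.infinitePi q))
    (hBE : B ⊆ {Θ | (E : ℂ) ∈ pointSpectrum (S.hamiltonian ψa ψb Λ R Θ)}) :
    Measure.infinitePi q B = 0 := by
  classical
  obtain ⟨n₀, hn₀⟩ := hq
  have : NullSingletonClass (q n₀) := ⟨hn₀⟩
  refine infinitePi_eq_zero_of_forall_update n₀ q hB fun Θ => ?_
  have hcount := SturmData.countable_setOf_update_mem_pointSpectrum (ψa := ψa) (ψb := ψb)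
    (fun n => (hR n).ne') hleft hright E n₀ Θ
  have hsub : {t | Function.update Θ n₀ t ∈ B} ⊆
      {t | (E : ℂ) ∈ pointSpectrum (S.hamiltonian ψa ψb Λ R (Function.update Θ n₀ t))} :=
    fun _ ht => hBE ht
  exact (hcount.mono hsub).measure_zero _
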